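/- Let $\mathcal{SK}_\omega$ be the monoid presented by generators $\lfloor k\rfloor$ (cups), $\lceil k\rceil$ (caps) and $\sigma_k$ (crossings), one of each for every integer $k\ge 1$, and the following equations, for all integers $i\ge 1$ and $1\le j\le k$: - $\lfloor k\rfloor\lfloor j\rfloor=\lfloor j\rfloor\lfloor k+2\rfloor$, $\ \lceil j\rceil\lceil k\rceil=\lceil k+2\rceil\lceil j\rceil$, $\ \lfloor k+2\rfloor\lceil j\rceil=\lceil j\rceil\lfloor k\rfloor$, $\ \lfloor j\rfloor\lceil k+2\rceil=\lceil k\rceil\lfloor j\rfloor$, $\ \lfloor i\rfloor\lceil i+1\rceil=\mathbf 1$; - $\sigma_{k+2}\sigma_j=\sigma_j\sigma_{k+2}$, $\ \sigma_i\sigma_i=\mathbf 1$, $\ \sigma_{i+1}\sigma_i\sigma_{i+1}=\sigma_i\sigma_{i+1}\sigma_i$; - $\lfloor k+2\rfloor\sigma_j=\sigma_j\lfloor k+2\rfloor$, $\ \lfloor j\rfloor\sigma_{k+2}=\sigma_k\lfloor j\rfloor$, $\ \lfloor i\rfloor\sigma_i=\lfloor i\rfloor$, $\ \lfloor i+1\rfloor\sigma_i=\lfloor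 i\rfloor\sigma_{i+1}$; - $\sigma_j\lceil k+2\rceil=\lceil k+2\rceil\sigma_j$, $\ \sigma_{k+2}\lceil j\rceil=\lceil j\rceil\sigma_k$, $\ \sigma_i\lceil i\rceil=\lceil i\rceil$, $\ \sigma_i\lceil i+1\rceil=\sigma_{i+1}\lceil i\rceil$. In $\mathcal{SK}_\omega$ all the products $\lfloor k\rfloor\lceil k\rceil$ are equal; let $c=\lfloor 1\rfloor\lceil 1\rceil$ be their common value (the circle). (a) (Maximality of $\mathcal{SK}_\omega$.) Let $t$ and $u$ be words in the generators such that $t=u$ does not hold in $\mathcal{SK}_\omega$, and let $\mathcal X$ be the monoid with the same generators, the above equations, and the additional equation $t=u$. Then there are $k,l\in\mathbf N$ with $k\ne l$ such that $c^k=c^l$ in $\mathcal X$. (b) Let $h$ be a monoid homomorphism from $\mathcal{SK}_\omega$ to a monoid $\mathcal M$. Then $h$ is injective if and only if $h(c^k)\ne h(c^l)$ for all $k,l\in\mathbf N$ with $k\ne l$. Likewise, $\mathcal{SK}_\omega$ is isomorphic to the submonoid $h(\mathcal{SK}_\omega)$ of $\mathcal M$ if and only if $h(c^k)\ne h(c^l)$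 for all $k,l\in\mathbf N$ with $k\ne l$. -/

import Mathlib

namespace SymSelfAdj

/-- The generators: for every positive integer `k` a cup term `⌊k⌋`, a cap term `⌈k⌉`
and a crossing term `σ_k`. -/
inductive Gen : Type
  | cup (k : ℕ+) : Gen
  | cap (k : ℕ+) : Gen
  | cross (k : ℕ+) : Gen

/-- Terms, taken up to the monoid equations: words in the generators. -/
abbrev Term : Type := FreeMonoid Gen

/-- The cup term of index `k`. -/
def cup (k : ℕ+) : Term := FreeMonoid.of (Gen.cup k)

/-- The cap term of index `k`. -/
def cap (k : ℕ+) : Term := FreeMonoid.of (Gen.cap k)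

/-- The crossing term of index `k`. -/
def cross (k : ℕ+) : Term := FreeMonoid.of (Gen.cross k)

/-- The defining equations of `SK_ω` other than the monoid equations. -/
inductive SKRel : Term → Term → Prop
  -- cup-cap equations
  | cup_cup (j k : ℕ+) : j ≤ k → SKRel (cup k * cup j) (cup j * cup (k + 2))
  | cap_cap (j k : ℕ+) : j ≤ k → SKRel (cap j * cap k) (cap (k + 2) * cap j)
  | cup_cap_comm (j k : ℕ+) : j ≤ k → SKRel (cup (k + 2) * cap j) (cap j * cup k)
  | cap_cup_comm (j k : ℕ+) : j ≤ k → SKRel (cup j * cap (k + 2)) (cap k * cup j)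
  | cup_cap (i : ℕ+) : SKRel (cup i * cap (i + 1)) 1
  -- crossing equations
  | cross_comm (j k : ℕ+) : j ≤ k →
      SKRel (cross (k + 2) * cross j) (cross j * cross (k + 2))
  | cross_sq (i : ℕ+) : SKRel (cross i * cross i) 1
  | cross_braid (i : ℕ+) :
      SKRel (cross (i + 1) * cross i * cross (i + 1)) (cross i * cross (i + 1) * cross i)
  -- crossing-cup equations
  | cross_cup_one (j k : ℕ+) : j ≤ k →
      SKRel (cup (k + 2) * cross j) (cross j * cup (k + 2))
  | cross_cup_two (j k : ℕ+) : j ≤ k → SKRel (cup j * cross (k + 2)) (cross k * cup j)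
  | cross_cup_three (i : ℕ+) : SKRel (cup i * cross i) (cup i)
  | cross_cup_four (i : ℕ+) : SKRel (cup (i + 1) * cross i) (cup i * cross (i + 1))
  -- crossing-cap equations
  | cross_cap_one (j k : ℕ+) : j ≤ k →
      SKRel (cross j * cap (k + 2)) (cap (k + 2) * cross j)
  | cross_cap_two (j k : ℕ+) : j ≤ k → SKRel (cross (k + 2) * cap j) (cap j * cross k)
  | cross_cap_three (i : ℕ+) : SKRel (cross i * cap i) (cap i)
  | cross_cap_four (i : ℕ+) : SKRel (cross i * cap (i + 1)) (cross (i + 1) * cap i)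

/-- The monoid `SK_ω`. -/
abbrev SK : Type := PresentedMonoid SKRel

/-- The defining equations of `SK_ω` together with the additional equation `t = u`. -/
def AddRel (t u : Term) (a b : Term) : Prop := SKRel a b ∨ (a = t ∧ b = u)

/-- The monoid defined as `SK_ω`, save that the additional equation `t = u` is assumed. -/
abbrev SKAdd (t u : Term) : Type := PresentedMonoid (AddRel t u)

/-- The equation `t = u` holds in `SK_ω`. -/
def HoldsInSK (t u : Term) : Prop := PresentedMonoid.mk SKRel t = PresentedMonoid.mk SKRel u

/-- The circle `c`. All the terms `⌊k⌋⌈k⌉` are equal in `SK_ω` (see `holdsInSK_circle`); the one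
with `k = 1` is taken. -/
def circle : Term := cup 1 * cap 1

/-- The circle does not depend on the index: `⌊k⌋⌈k⌉ = c` holds in `SK_ω` for every `k`. -/
theorem holdsInSK_circle (k : ℕ+) : HoldsInSK (cup k * cap k) circle := by
  induction k using PNat.recOn with
  | one => rfl
  | succ k ih =>
    refine Eq.trans ?_ ih
    have h4 := PresentedMonoid.mk_eq_mk_of_rel (SKRel.cross_cup_four k)
    have h4' := PresentedMonoid.mk_eq_mk_of_rel (SKRel.cross_cap_four k)
    have h2 := PresentedMonoid.mk_eq_mk_of_rel (SKRel.cross_sq k)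
    have h2' := PresentedMonoid.mk_eq_mk_of_rel (SKRel.cross_sq (k + 1))
    simp only [map_mul, map_one] at *
    generalize PresentedMonoid.mk SKRel (cup k) = d at *
    generalize PresentedMonoid.mk SKRel (cup (k + 1)) = d' at *
    generalize PresentedMonoid.mk SKRel (cap k) = g at *
    generalize PresentedMonoid.mk SKRel (cap (k + 1)) = g' at *
    generalize PresentedMonoid.mk SKRel (cross k) = s at *
    generalize PresentedMonoid.mk SKRel (cross (k + 1)) = s' at *
    calc d' * g' = d' * (s * s) * g' := by rw [h2, mul_one]
      _ = (d' * s) * (s * g') := by simp only [mul_assoc]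
      _ = d * (s' * s') * g := by rw [h4, h4']; simp only [mul_assoc]
      _ = d * g := by rw [h2', mul_one]

end SymSelfAdj

/-! Elements of `SK` are handled as diagrams, read from top to bottom, of arcs and through strands
with a central factor counting circles. Every diagram can be multiplied on both sides into a power
of the circle (`exists_mul_mul_eq_circ_pow`).

Let `f` identify distinct `x` and `y`, padded to equally many top strands. If their bottom numbers
differ, a cup to the right of both is shifted by different amounts on crossing them. Closing up
gives `circ ^ p * dn k ~ circ ^ p * dn (k + e + 3)`, whence `circ ^ (p + 2) ~ circ ^ p`. If the
bottom numbers agree, bending all top strands down reduces both to the normal form `circ ^ p * (dn 0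
^ r * y)` with `y` a product of crossings. Closing both by the mirror image of either one gives `r`
circles for matching arcs and fewer for different arcs, so all exponents can agree only if `x = y`.

Conversely, a tensor representation in which the circle acts as 2 separates its powers. An abstract
isomorphism with the image of `h` yields a surjective endomorphism of `SK`; were it to identify
powers of the circle, periodicity would make some element divisible by arbitrarily high powers of
the circle, which no element is. -/

namespace SymSelfAdj

/-! ### Generators indexed from zero, and the central circle -/

/-- The class in `SK_ω` of the cup of index `k + 1`. -/
def dn (k : ℕ) : SK := PresentedMonoid.mk SKRel (cup k.succPNat)

/-- The class in `SK_ω` of the cap of index `k + 1`. -/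
def up (k : ℕ) : SK := PresentedMonoid.mk SKRel (cap k.succPNat)

/-- The class in `SK_ω` of the crossing of index `k + 1`. -/
def tw (k : ℕ) : SK := PresentedMonoid.mk SKRel (cross k.succPNat)

/-- The class in `SK_ω` of the circle. -/
def circ : SK := PresentedMonoid.mk SKRel circle

theorem dn_dn {j k : ℕ} (h : j ≤ k) : dn k * dn j = dn j * dn (k + 2) :=
  PresentedMonoid.mk_eq_mk_of_rel (SKRel.cup_cup j.succPNat k.succPNat (Nat.succPNat_le_succPNat.2 h))

theorem up_up {j k : ℕ} (h : j ≤ k) : up j * up k = up (k + 2) * up j :=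
  PresentedMonoid.mk_eq_mk_of_rel (SKRel.cap_cap j.succPNat k.succPNat (Nat.succPNat_le_succPNat.2 h))

theorem dn_up_right {j k : ℕ} (h : j ≤ k) : dn (k + 2) * up j = up j * dn k :=
  PresentedMonoid.mk_eq_mk_of_rel (SKRel.cup_cap_comm j.succPNat k.succPNat (Nat.succPNat_le_succPNat.2 h))

theorem dn_up_left {j k : ℕ} (h : j ≤ k) : dn j * up (k + 2) = up k * dn j :=
  PresentedMonoid.mk_eq_mk_of_rel (SKRel.cap_cup_comm j.succPNat k.succPNat (Nat.succPNat_le_succPNat.2 h))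

theorem dn_up_succ (i : ℕ) : dn i * up (i + 1) = 1 :=
  PresentedMonoid.mk_eq_mk_of_rel (SKRel.cup_cap i.succPNat)

theorem tw_tw_comm {j k : ℕ} (h : j ≤ k) : tw (k + 2) * tw j = tw j * tw (k + 2) :=
  PresentedMonoid.mk_eq_mk_of_rel (SKRel.cross_comm j.succPNat k.succPNat (Nat.succPNat_le_succPNat.2 h))

theorem tw_sq (i : ℕ) : tw i * tw i = 1 :=
  PresentedMonoid.mk_eq_mk_of_rel (SKRel.cross_sq i.succPNat)

theorem tw_braid (i : ℕ) : tw (i + 1) * tw i * tw (i + 1) = tw i * tw (i + 1) * tw i :=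
  PresentedMonoid.mk_eq_mk_of_rel (SKRel.cross_braid i.succPNat)

theorem dn_tw_left {j k : ℕ} (h : j ≤ k) : dn (k + 2) * tw j = tw j * dn (k + 2) :=
  PresentedMonoid.mk_eq_mk_of_rel (SKRel.cross_cup_one j.succPNat k.succPNat (Nat.succPNat_le_succPNat.2 h))

theorem dn_tw_right {j k : ℕ} (h : j ≤ k) : dn j * tw (k + 2) = tw k * dn j :=
  PresentedMonoid.mk_eq_mk_of_rel (SKRel.cross_cup_two j.succPNat k.succPNat (Nat.succPNat_le_succPNat.2 h))

theorem dn_tw_self (i : ℕ) : dn i * tw i = dn i :=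
  PresentedMonoid.mk_eq_mk_of_rel (SKRel.cross_cup_three i.succPNat)

theorem dn_succ_tw (i : ℕ) : dn (i + 1) * tw i = dn i * tw (i + 1) :=
  PresentedMonoid.mk_eq_mk_of_rel (SKRel.cross_cup_four i.succPNat)

theorem tw_up_left {j k : ℕ} (h : j ≤ k) : tw j * up (k + 2) = up (k + 2) * tw j :=
  PresentedMonoid.mk_eq_mk_of_rel (SKRel.cross_cap_one j.succPNat k.succPNat (Nat.succPNat_le_succPNat.2 h))

theorem tw_up_right {j k : ℕ} (h : j ≤ k) : tw (k + 2) * up j = up j * tw k :=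
  PresentedMonoid.mk_eq_mk_of_rel (SKRel.cross_cap_two j.succPNat k.succPNat (Nat.succPNat_le_succPNat.2 h))

theorem tw_up_self (i : ℕ) : tw i * up i = up i :=
  PresentedMonoid.mk_eq_mk_of_rel (SKRel.cross_cap_three i.succPNat)

theorem tw_up_succ (i : ℕ) : tw i * up (i + 1) = tw (i + 1) * up i :=
  PresentedMonoid.mk_eq_mk_of_rel (SKRel.cross_cap_four i.succPNat)

theorem dn_up_self (k : ℕ) : dn k * up k = circ := holdsInSK_circle _

theorem dn_succ_up (i : ℕ) : dn (i + 1) * up i = 1 :=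
  calc dn (i + 1) * up i = dn (i + 1) * (tw (i + 1) * up i) := by
        rw [← mul_assoc, dn_tw_self]
    _ = dn (i + 1) * tw i * up (i + 1) := by rw [← tw_up_succ, mul_assoc]
    _ = dn i * (tw (i + 1) * up (i + 1)) := by rw [dn_succ_tw, mul_assoc]
    _ = 1 := by rw [tw_up_self, dn_up_succ]

@[elab_as_elim]
theorem SK.induction {p : SK → Prop} (one : p 1) (dn_mul : ∀ x k, p x → p (x * dn k))
    (up_mul : ∀ x k, p x → p (x * up k)) (tw_mul : ∀ x k, p x → p (x * tw k)) (x : SK) : p x := by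
  have key (w : Term) : ∀ x, p x → p (x * PresentedMonoid.mk SKRel w) := by
    induction w using FreeMonoid.inductionOn' with
    | one => simp
    | of_mul g w ih =>
      intro x hx
      rw [map_mul, ← mul_assoc]
      apply ih
      rcases g with k | k | k
      · simpa [dn, cup] using dn_mul x k.natPred hx
      · simpa [up, cap] using up_mul x k.natPred hx
      · simpa [tw, cross] using tw_mul x k.natPred hx
  induction x using PresentedMonoid.inductionOn with
  | h w => simpa using key w 1 one

/-- The circle can be created at any index, in particular at one from which the commutation
relations carry it across the given generator. -/
theorem circ_mul_comm (x : SK) : circ * x = x * circ := by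
  induction x using SK.induction with
  | one => simp
  | dn_mul x k ih =>
    have h : circ * dn k = dn k * circ := by
      rw [← dn_up_self k, mul_assoc, ← dn_up_left le_rfl, ← mul_assoc, dn_dn le_rfl, mul_assoc,
        dn_up_self, dn_up_self]
    rw [← mul_assoc, ih, mul_assoc, h, mul_assoc]
  | up_mul x k ih =>
    have h : circ * up k = up k * circ := by
      rw [← dn_up_self (k + 2), mul_assoc, ← up_up le_rfl, ← mul_assoc, dn_up_right le_rfl,
        mul_assoc, dn_up_self, dn_up_self]
    rw [← mul_assoc, ih, mul_assoc, h, mul_assoc]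
  | tw_mul x k ih =>
    have h : circ * tw k = tw k * circ := by
      rw [← dn_up_self (k + 2), mul_assoc, ← tw_up_left le_rfl, ← mul_assoc, dn_tw_left le_rfl,
        mul_assoc]
    rw [← mul_assoc, ih, mul_assoc, h, mul_assoc]

theorem circ_pow_mul_comm (n : ℕ) (x : SK) : circ ^ n * x = x * circ ^ n :=
  Commute.pow_left (circ_mul_comm x) n

/-! ### Strand counts and bending -/

/-- `Strands n m x`: the element `x` is a product of generators which act on the first `n` of
the strands at the top and on the first `m` of the strands at the bottom. -/
inductive Strands (n : ℕ) : ℕ → SK → Prop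
  | one : Strands n n 1
  | dn {m : ℕ} {x : SK} (k : ℕ) (hk : k ≤ m) : Strands n m x → Strands n (m + 2) (x * dn k)
  | up {m : ℕ} {x : SK} (k : ℕ) (hk : k ≤ m) : Strands n (m + 2) x → Strands n m (x * up k)
  | tw {m : ℕ} {x : SK} (k : ℕ) (hk : k + 2 ≤ m) : Strands n m x → Strands n m (x * tw k)

theorem Strands.add {n m : ℕ} {x : SK} (h : Strands n m x) (j : ℕ) :
    Strands (n + j) (m + j) x := by
  induction h with
  | one => exact .one
  | dn k hk _ ih => 
    rw [add_right_comm]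
    exact .dn k (by omega) ih
  | up k hk _ ih => exact .up k (by omega) (by rwa [add_right_comm] at ih)
  | tw k hk _ ih => exact .tw k (by omega) ih

theorem Strands.mul {n m l : ℕ} {x y : SK} (hx : Strands n m x) (hy : Strands m l y) :
    Strands n l (x * y) := by
  induction hy with
  | one => simpa using hx
  | dn k hk _ ih => rw [← mul_assoc]; exact .dn k hk ih
  | up k hk _ ih => rw [← mul_assoc]; exact .up k hk ih
  | tw k hk _ ih => rw [← mul_assoc]; exact .tw k hk ih

theorem exists_strands (x : SK) : ∃ n m, Strands n m x := by
  induction x using SK.induction with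
  | one => exact ⟨0, 0, .one⟩
  | dn_mul x k ih =>
    obtain ⟨n, m, h⟩ := ih
    exact ⟨_, _, .dn k (by omega) (h.add k)⟩
  | up_mul x k ih =>
    obtain ⟨n, m, h⟩ := ih
    exact ⟨_, m + k, .up k (by omega) (h.add (k + 2))⟩
  | tw_mul x k ih =>
    obtain ⟨n, m, h⟩ := ih
    exact ⟨_, _, .tw k (by omega) (h.add (k + 2))⟩

/-- To the right of its strands `x` is the identity, up to the shift from `n` to `m`. -/
theorem Strands.dn_mul {n m : ℕ} {x : SK} (h : Strands n m x) (j : ℕ) :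
    SymSelfAdj.dn (n + j) * x = x * SymSelfAdj.dn (m + j) := by
  induction h with
  | one => simp
  | @dn m x k hk _ ih =>
    rw [← mul_assoc, ih, mul_assoc, mul_assoc, dn_dn (by omega), add_right_comm]
  | @up m x k hk _ ih =>
    rw [← mul_assoc, ih, mul_assoc, mul_assoc, add_right_comm, dn_up_right (by omega)]
  | @tw m x k hk _ ih =>
    obtain ⟨m, rfl⟩ := Nat.exists_eq_add_of_le' (show 2 ≤ m by omega)
    rw [← mul_assoc, ih, mul_assoc, mul_assoc, add_right_comm, dn_tw_left (by omega)]

theorem Strands.up_mul {n m : ℕ} {x : SK} (h : Strands n m x) (j : ℕ) :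
    SymSelfAdj.up (n + j) * x = x * SymSelfAdj.up (m + j) := by
  induction h with
  | one => simp
  | @dn m x k hk _ ih =>
    rw [← mul_assoc, ih, mul_assoc, mul_assoc, add_right_comm, dn_up_left (by omega)]
  | @up m x k hk _ ih =>
    rw [← mul_assoc, ih, mul_assoc, mul_assoc, add_right_comm,
      ← up_up (show k ≤ m + j by omega)]
  | @tw m x k hk _ ih =>
    obtain ⟨m, rfl⟩ := Nat.exists_eq_add_of_le' (show 2 ≤ m by omega)
    rw [← mul_assoc, ih, mul_assoc, mul_assoc, add_right_comm, tw_up_left (by omega)]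

/-- Bending all the strands at the top to the bottom. The element `a` depends on their number
only. -/
theorem exists_bend (n : ℕ) : ∃ a : SK, ∀ m, ∃ b : SK, ∀ x, Strands n m x →
    Strands 0 (m + n) (a * x) ∧ a * x * b = x := by
  induction n with
  | zero => exact ⟨1, fun m => ⟨1, fun x hx => by simpa using hx⟩⟩
  | succ n ih =>
    obtain ⟨a, ha⟩ := ih
    refine ⟨a * dn n, fun m => ?_⟩
    obtain ⟨b, hb⟩ := ha (m + 1)
    refine ⟨b * up m, fun x hx => ?_⟩
    have h : Strands n (m + 1) (dn n * x) := by
      have h1 : Strands n (n + 2) (dn n) := by simpa using Strands.dn n le_rfl (.one)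
      exact h1.mul (hx.add 1)
    obtain ⟨h1, h2⟩ := hb _ h
    refine ⟨by rw [mul_assoc, ← add_assoc, add_right_comm]; exact h1, ?_⟩
    -- Sliding `up` across `x` turns the last bent strand into a zigzag, which straightens.
    rw [← mul_assoc, mul_assoc a, h2, mul_assoc, ← add_zero m, ← hx.up_mul 0, ← mul_assoc, dn_up_succ, one_mul]

/-! ### Permutations of strands and systems of arcs -/

/-- The submonoid generated by the crossings that permute the strands `a, …, n - 1`. -/
def crossings (a n : ℕ) : Submonoid SK :=
  Submonoid.closure {x | ∃ j, a ≤ j ∧ j + 2 ≤ n ∧ x = tw j}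

theorem tw_mem_crossings {a n j : ℕ} (ha : a ≤ j) (hn : j + 2 ≤ n) : tw j ∈ crossings a n :=
  Submonoid.subset_closure ⟨j, ha, hn, rfl⟩

theorem crossings_mono {a a' n n' : ℕ} (ha : a' ≤ a) (hn : n ≤ n') :
    crossings a n ≤ crossings a' n' :=
  Submonoid.closure_mono fun _ ⟨j, h1, h2, h3⟩ => ⟨j, ha.trans h1, h2.trans hn, h3⟩

theorem exists_inverse_of_mem_crossings {a n : ℕ} {x : SK} (h : x ∈ crossings a n) :
    ∃ y ∈ crossings a n, x * y = 1 ∧ y * x = 1 := by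
  induction h using Submonoid.closure_induction with
  | mem x hx =>
    obtain ⟨j, h1, h2, rfl⟩ := hx
    exact ⟨_, tw_mem_crossings h1 h2, tw_sq j, tw_sq j⟩
  | one => exact ⟨1, one_mem _, by simp, by simp⟩
  | mul x x' _ _ ih ih' =>
    obtain ⟨y, hy, h1, h2⟩ := ih
    obtain ⟨y', hy', h1', h2'⟩ := ih'
    refine ⟨y' * y, mul_mem hy' hy, ?_, ?_⟩
    · rw [mul_assoc, ← mul_assoc x', h1', one_mul, h1]
    · rw [mul_assoc, ← mul_assoc y, h2, one_mul, h2']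

theorem exists_mul_dn_zero {n : ℕ} {x : SK} (h : x ∈ crossings 0 n) :
    ∃ y ∈ crossings 0 (n + 2), x * dn 0 = dn 0 * y := by
  induction h using Submonoid.closure_induction with
  | mem x hx =>
    obtain ⟨j, h1, h2, rfl⟩ := hx
    exact ⟨_, tw_mem_crossings (Nat.zero_le _) (by omega), (dn_tw_right (Nat.zero_le j)).symm⟩
  | one => exact ⟨1, one_mem _, by simp⟩
  | mul x x' _ _ ih ih' =>
    obtain ⟨y, hy, h⟩ := ih
    obtain ⟨y', hy', h'⟩ := ih'
    exact ⟨y * y', mul_mem hy hy', by rw [mul_assoc, h', ← mul_assoc, h, mul_assoc]⟩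

theorem exists_dn_eq (k : ℕ) : ∃ y ∈ crossings 0 (k + 2), dn k = dn 0 * y := by
  induction k with
  | zero => exact ⟨1, one_mem _, by simp⟩
  | succ k ih =>
    obtain ⟨y, hy, h⟩ := ih
    refine ⟨y * (tw (k + 1) * tw k), mul_mem (crossings_mono le_rfl (by omega) hy)
      (mul_mem (tw_mem_crossings (by omega) le_rfl) (tw_mem_crossings (by omega) (by omega))), ?_⟩
    rw [← mul_assoc, ← h, ← mul_assoc, ← dn_succ_tw, mul_assoc, tw_sq, mul_one]

theorem exists_up_eq (k : ℕ) : ∃ y ∈ crossings 0 (k + 2), up k = y * up 0 := by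
  induction k with
  | zero => exact ⟨1, one_mem _, by simp⟩
  | succ k ih =>
    obtain ⟨y, hy, h⟩ := ih
    refine ⟨tw k * tw (k + 1) * y, mul_mem (mul_mem (tw_mem_crossings (by omega) (by omega))
      (tw_mem_crossings (by omega) le_rfl)) (crossings_mono le_rfl (by omega) hy), ?_⟩
    rw [mul_assoc, ← h, mul_assoc, ← tw_up_succ, ← mul_assoc, tw_sq, one_mul]

/-- The product of the crossings with the indices `1, …, k`. -/
def twRun : ℕ → SK
  | 0 => 1
  | k + 1 => twRun k * tw (k + 1)

theorem twRun_mul_tw_of_le {k j : ℕ} (h : k + 2 ≤ j) : twRun k * tw j = tw j * twRun k := by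
  induction k with
  | zero => simp [twRun]
  | succ k ih =>
    obtain ⟨j, rfl⟩ := Nat.exists_eq_add_of_le' (show 2 ≤ j by omega)
    rw [twRun, mul_assoc, ← tw_tw_comm (by omega), ← mul_assoc, ih (by omega), mul_assoc]

theorem twRun_mul_tw_of_lt {k j : ℕ} (h : j + 1 < k) :
    twRun k * tw (j + 1) = tw (j + 2) * twRun k := by
  induction k with
  | zero => omega
  | succ k ih =>
    rcases Nat.lt_succ_iff_lt_or_eq.1 h with h | rfl
    · obtain ⟨k, rfl⟩ := Nat.exists_eq_add_of_le' (show 1 ≤ k by omega)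
      rw [twRun, mul_assoc, tw_tw_comm (by omega), ← mul_assoc, ih (by omega), mul_assoc]
    · rw [twRun, twRun, mul_assoc, mul_assoc, ← mul_assoc (tw (j + 1)), ← tw_braid, ← mul_assoc,
        ← mul_assoc, ← mul_assoc, twRun_mul_tw_of_le le_rfl]
      simp only [mul_assoc]

/-- The arc from the first strand is moved to the second and thus frees the first; the remaining
crossings touch neither of the two. -/
theorem exists_dn_zero_mul_twRun_mul_tw_zero (k : ℕ) :
    ∃ y ∈ crossings 2 (k + 3), dn 0 * twRun (k + 1) * tw 0 = dn 1 * y := by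
  induction k with
  | zero =>
    refine ⟨1, one_mem _, ?_⟩
    rw [twRun, twRun, one_mul, ← dn_succ_tw, mul_assoc, tw_sq]
  | succ k ih =>
    obtain ⟨y, hy, h⟩ := ih
    refine ⟨y * tw (k + 2), mul_mem (crossings_mono le_rfl (by omega) hy)
      (tw_mem_crossings (by omega) (by omega)), ?_⟩
    rw [twRun, mul_assoc, mul_assoc, tw_tw_comm (Nat.zero_le k), ← mul_assoc, ← mul_assoc, h,
      mul_assoc]

/-- The arc at the first strand steps over the two strands of the inserted arc, so its run grows by
two. -/
theorem dn_zero_mul_twRun_mul_dn_one (k : ℕ) :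
    dn 0 * twRun k * dn 1 = dn 0 * dn 0 * twRun (k + 2) := by
  induction k with
  | zero =>
    have h : dn 2 * tw 1 = dn 1 * tw 2 := dn_succ_tw 1
    simp only [twRun, mul_one, one_mul, zero_add]
    rw [dn_dn le_rfl, ← mul_assoc, mul_assoc (dn 0), h, mul_assoc, mul_assoc, tw_sq, mul_one]
  | succ k ih =>
    rw [twRun, mul_assoc, mul_assoc, ← dn_tw_right (Nat.le_add_left 1 k), ← mul_assoc, ← mul_assoc,
      ih, twRun, mul_assoc]
    rfl

theorem dn_zero_mul_twRun_mul_up_zero (k : ℕ) :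
    dn 0 * twRun (k + 1) * up 0 ∈ crossings 0 (k + 1) := by
  induction k with
  | zero =>
    rw [twRun, twRun, one_mul, mul_assoc, ← tw_up_succ, ← mul_assoc, dn_tw_self, dn_up_succ]
    exact one_mem _
  | succ k ih =>
    rw [twRun, mul_assoc, mul_assoc, tw_up_right (Nat.zero_le k), ← mul_assoc, ← mul_assoc]
    exact mul_mem (crossings_mono le_rfl (by omega) ih) (tw_mem_crossings (by omega) (by omega))

/-- The elements consisting of `r` arcs on `2 * r` strands, to which an arc is added that joins
the new first strand to another one. -/
def FirstArc (r : ℕ) (x : SK) : Prop :=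
  ∃ y ∈ crossings 0 (2 * r), ∃ k ≤ 2 * r, x = dn 0 ^ r * y * dn 0 * twRun k

theorem FirstArc.mul_tw {r j : ℕ} {x : SK} (h : FirstArc r x) (hj : j + 1 ≤ 2 * r) :
    FirstArc r (x * tw (j + 1)) := by
  obtain ⟨y, hy, k, hk, rfl⟩ := h
  have move {i : ℕ} (hi : i + 2 ≤ 2 * r) (h : twRun k * tw (j + 1) = tw (i + 2) * twRun k) :
      FirstArc r (dn 0 ^ r * y * dn 0 * twRun k * tw (j + 1)) := by
    refine ⟨y * tw i, mul_mem hy (tw_mem_crossings (by omega) hi), k, hk, ?_⟩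
    rw [mul_assoc, h, ← mul_assoc, mul_assoc _ (dn 0), dn_tw_right (Nat.zero_le i), ← mul_assoc,
      ← mul_assoc]
  -- The arc ends at strand `k + 1`. The crossing moves this end when `j + 1 = k` or `j = k`;
  -- otherwise it passes up into `y`.
  rcases lt_trichotomy (j + 1) k with h | h | h
  · exact move (by omega) (twRun_mul_tw_of_lt h)
  · refine ⟨y, hy, j, by omega, ?_⟩
    rw [← h, twRun, mul_assoc, mul_assoc (twRun j), tw_sq, mul_one]
  · rcases (Nat.succ_le_iff.2 h).eq_or_lt with h | h
    · obtain rfl : k = j := by omega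
      exact ⟨y, hy, k + 1, hj, by rw [twRun, mul_assoc]⟩
    · obtain ⟨j, rfl⟩ := Nat.exists_eq_add_of_le' (show 1 ≤ j by omega)
      exact move (by omega) (twRun_mul_tw_of_le (by omega))

theorem FirstArc.mul {r : ℕ} {x y : SK} (h : FirstArc r x) (hy : y ∈ crossings 1 (2 * r + 2)) :
    FirstArc r (x * y) := by
  induction hy using Submonoid.closure_induction_right with
  | one => simpa using h
  | mul_right y _ z hz ih =>
    obtain ⟨j, h1, h2, rfl⟩ := hz
    obtain ⟨j, rfl⟩ := Nat.exists_eq_add_of_le' h1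
    rw [← mul_assoc]
    exact ih.mul_tw (by omega)

theorem firstArc_dn_zero_pow_mul (r : ℕ) {x : SK} (hx : x ∈ crossings 0 (2 * r + 2)) :
    FirstArc r (dn 0 ^ (r + 1) * x) := by
  induction r generalizing x with
  | zero =>
    refine ⟨1, one_mem _, 0, le_rfl, ?_⟩
    induction hx using Submonoid.closure_induction_right with
    | one => simp [twRun]
    | mul_right y _ z hz ih =>
      obtain ⟨j, h1, h2, rfl⟩ := hz
      obtain rfl : j = 0 := by omega
      rw [← mul_assoc, ih]
      simp [twRun, dn_tw_self]
  | succ r IH =>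
    induction hx using Submonoid.closure_induction_right with
    | one => exact ⟨1, one_mem _, 0, by omega, by simp [twRun, pow_succ]⟩
    | mul_right y _ z hz ih =>
      obtain ⟨j, h1, h2, rfl⟩ := hz
      rw [← mul_assoc]
      -- Only `tw 0` moves the first strand.
      rcases j with _ | j
      · obtain ⟨y, hy, k, hk, h⟩ := ih
        rw [h]
        rcases k with _ | k
        · exact ⟨y, hy, 0, by omega, by simp [twRun, mul_assoc, dn_tw_self]⟩
        · obtain ⟨w, hw, h3⟩ := exists_dn_zero_mul_twRun_mul_tw_zero k
          -- The first strand now belongs to one of the other arcs, which the induction on `r`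
          -- singles out.
          obtain ⟨y', hy', l, hl, h4⟩ := IH hy
          obtain ⟨v, hv, h5⟩ := exists_mul_dn_zero hy'
          have : FirstArc (r + 1) (dn 0 ^ (r + 1) * v * dn 0 * twRun (l + 2)) :=
            ⟨v, hv, l + 2, by omega, rfl⟩
          convert this.mul (crossings_mono (by omega) (by omega) hw) using 1
          calc dn 0 ^ (r + 1) * y * dn 0 * twRun (k + 1) * tw 0
              = dn 0 ^ (r + 1) * y * (dn 0 * twRun (k + 1) * tw 0) := by simp only [mul_assoc]
            _ = dn 0 ^ r * y' * (dn 0 * twRun l * dn 1) * w := by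
              rw [h3, h4]; simp only [mul_assoc]
            _ = dn 0 ^ r * (y' * dn 0) * dn 0 * twRun (l + 2) * w := by
              rw [dn_zero_mul_twRun_mul_dn_one]; simp only [mul_assoc]
            _ = _ := by rw [h5, pow_succ]; simp only [mul_assoc]
      · exact ih.mul_tw (by omega)

/-- A cap on the first two strands either meets a single arc, which it closes to a circle, or merges
two arcs into one. -/
theorem dn_zero_pow_mul_cases {r : ℕ} {x : SK} (hx : x ∈ crossings 0 (2 * r + 2)) :
    ∃ y ∈ crossings 0 (2 * r), dn 0 ^ (r + 1) * x = dn 0 ^ r * y * dn 0 ∨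
      dn 0 ^ (r + 1) * x * up 0 = dn 0 ^ r * y := by
  obtain ⟨y, hy, k, hk, h⟩ := firstArc_dn_zero_pow_mul r hx
  rcases k with _ | k
  · exact ⟨y, hy, .inl (by simpa [twRun] using h)⟩
  · refine ⟨y * (dn 0 * twRun (k + 1) * up 0), mul_mem hy
      (crossings_mono le_rfl (by omega) (dn_zero_mul_twRun_mul_up_zero k)), .inr ?_⟩
    rw [h]
    simp only [mul_assoc]

/-- Closing `r` arcs on `2 * r` strands by `r` arcs gives `s ≤ r` circles, and `r` circles only
if both systems of arcs are the same. -/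
theorem exists_dn_zero_pow_mul_up_zero_pow {r : ℕ} {x : SK} (hx : x ∈ crossings 0 (2 * r)) :
    ∃ s ≤ r, dn 0 ^ r * x * up 0 ^ r = circ ^ s ∧ (s = r → dn 0 ^ r * x = dn 0 ^ r) := by
  induction r generalizing x with
  | zero =>
    refine ⟨0, le_rfl, ?_⟩
    suffices x = 1 by simp [this]
    induction hx using Submonoid.closure_induction with
    | mem x hx => obtain ⟨j, h1, h2, rfl⟩ := hx; omega
    | one => rfl
    | mul x y _ _ hx hy => rw [hx, hy, one_mul]
  | succ r ih =>
    obtain ⟨y, hy, h⟩ := dn_zero_pow_mul_cases hx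
    obtain ⟨s, hs, h1, h2⟩ := ih hy
    rcases h with h | h
    · refine ⟨s + 1, by omega, ?_, fun e => ?_⟩
      · rw [h, pow_succ' (up 0), ← mul_assoc, mul_assoc _ (dn 0), dn_up_self, ← circ_mul_comm,
          mul_assoc, h1, pow_succ']
      · rw [h, h2 (by omega), pow_succ]
    · exact ⟨s, by omega, by rw [pow_succ' (up 0), ← mul_assoc, h, h1], fun e => by omega⟩

/-! ### Normal form without top strands, and closing up -/

theorem exists_eq_of_strands_zero {m : ℕ} {x : SK} (h : Strands 0 m x) :
    ∃ r p, ∃ y ∈ crossings 0 (2 * r), m = 2 * r ∧ x = circ ^ p * (dn 0 ^ r * y) := by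
  induction h with
  | one => exact ⟨0, 0, 1, one_mem _, rfl, by simp⟩
  | dn k hk _ ih =>
    obtain ⟨r, p, y, hy, rfl, rfl⟩ := ih
    obtain ⟨z, hz, h1⟩ := exists_dn_eq k
    obtain ⟨w, hw, h2⟩ := exists_mul_dn_zero hy
    refine ⟨r + 1, p, w * z, mul_mem hw (crossings_mono le_rfl (by omega) hz), by omega, ?_⟩
    rw [h1, pow_succ]
    simp only [mul_assoc]
    rw [← mul_assoc y, h2, mul_assoc]
  | @up m _ k hk _ ih =>
    obtain ⟨r, p, y, hy, h, rfl⟩ := ih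
    obtain ⟨r, rfl⟩ := Nat.exists_eq_add_of_le' (show 1 ≤ r by omega)
    obtain ⟨z, hz, h1⟩ := exists_up_eq k
    have hyz := mul_mem hy (crossings_mono le_rfl (by omega) hz)
    obtain ⟨w, hw, h2⟩ := dn_zero_pow_mul_cases hyz
    rw [h1]
    rcases h2 with h2 | h2
    · refine ⟨r, p + 1, w, hw, by omega, ?_⟩
      calc circ ^ p * (dn 0 ^ (r + 1) * y) * (z * up 0)
          = circ ^ p * (dn 0 ^ (r + 1) * (y * z) * up 0) := by
            simp only [mul_assoc]
        _ = _ := by rw [h2, mul_assoc _ (dn 0), dn_up_self, ← circ_mul_comm,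
          ← mul_assoc, pow_succ]
    · refine ⟨r, p, w, hw, by omega, ?_⟩
      rw [← h2]
      simp only [mul_assoc]
  | tw k hk _ ih =>
    obtain ⟨r, p, y, hy, rfl, rfl⟩ := ih
    exact ⟨r, p, y * tw k, mul_mem hy (tw_mem_crossings (by omega) hk), rfl,
      by simp only [mul_assoc]⟩

theorem exists_mul_mul_eq_circ_pow (x : SK) : ∃ u v p, u * x * v = circ ^ p := by
  obtain ⟨n, m, hx⟩ := exists_strands x
  obtain ⟨a, ha⟩ := exists_bend n
  obtain ⟨b, hb⟩ := ha m
  obtain ⟨r, p, y, hy, -, h⟩ := exists_eq_of_strands_zero (hb x hx).1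
  obtain ⟨z, hz, h1, -⟩ := exists_inverse_of_mem_crossings hy
  obtain ⟨s, -, h2, -⟩ := exists_dn_zero_pow_mul_up_zero_pow (one_mem (crossings 0 (2 * r)))
  refine ⟨a, z * up 0 ^ r, p + s, ?_⟩
  rw [h, ← mul_assoc, mul_assoc _ _ z, mul_assoc _ y, h1, mul_assoc, h2, pow_add]

/-! ### Identifications force two powers of the circle to agree -/

theorem map_circ_pow_add_two {M : Type*} [Monoid M] (f : SK →* M) {p k e : ℕ}
    (h : f (circ ^ p * dn k) = f (circ ^ p * dn (k + e + 3))) :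
    f (circ ^ (p + 2)) = f (circ ^ p) := by
  have key (z : SK) : f (circ ^ p * (dn (k + 1) * (dn k * z))) =
      f (circ ^ p * (dn (k + 1) * (dn (k + e + 3) * z))) := by
    have (i : ℕ) : circ ^ p * (dn (k + 1) * (dn i * z)) =
        dn (k + 1) * (circ ^ p * dn i) * z := by
      rw [← mul_assoc, circ_pow_mul_comm]
      simp only [mul_assoc]
    rw [this, this, map_mul, map_mul, h, ← map_mul, ← map_mul]
  -- With `D = dn (k + e + 1)`, the two caps give `dn (k + 1) ~ circ * D` and `circ * dn (k + 1) ~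
  -- D`, up to `circ ^ p`. The gap of at least 3 lets both caps pass the far cup.
  have h1 := key (up (k + 1))
  have h2 := key (up k)
  rw [show k + e + 3 = k + e + 1 + 2 by omega, dn_up_right (by omega)] at h1 h2
  rw [dn_up_succ, mul_one, ← mul_assoc (dn _), dn_up_self] at h1
  rw [dn_up_self, ← circ_mul_comm, ← mul_assoc (dn _) (up _), dn_succ_up, one_mul] at h2
  have h3 : f (circ ^ (p + 2) * dn (k + 1)) = f (circ ^ p * dn (k + 1)) := by
    have h4 (z : SK) : f (circ ^ p * (circ * z)) = f circ * f (circ ^ p * z) := by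
      rw [← map_mul, ← mul_assoc, ← mul_assoc, ← pow_succ, pow_succ']
    rw [pow_add, pow_two, mul_assoc, mul_assoc, h4, h2, ← h4, h1]
  have h4 (q : ℕ) : f (circ ^ q) = f (circ ^ q * dn (k + 1)) * f (up (k + 1 + 1)) := by
    rw [← map_mul, mul_assoc, dn_up_succ, mul_one]
  rw [h4, h3, ← h4]

theorem exists_map_circ_pow_eq_of_lt {M : Type*} [Monoid M] (f : SK →* M) {n m m' : ℕ} {x y : SK}
    (hx : Strands n m x) (hy : Strands n m' y) (hm : m < m') (h : f x = f y) :
    ∃ k l, k ≠ l ∧ f circ ^ k = f circ ^ l := by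
  obtain ⟨u, v, p, hp⟩ := exists_mul_mul_eq_circ_pow x
  obtain ⟨α, β, hv⟩ := exists_strands v
  obtain ⟨e, rfl⟩ := Nat.exists_eq_add_of_le' (Nat.succ_le_iff.2 hm)
  -- A far cup enters `u * x * v` from below, passes `v` and `x`, and returns through `y` in place
  -- of `x`: the shift is `m' - m = e + 1`.
  have key (i : ℕ) : f (circ ^ p * dn (β + m + i)) = f (circ ^ p * dn (β + m + i + (e + 1))) := by
    have hc (i : ℕ) : f (circ ^ p * dn (β + i)) = f u * (f x * f (dn (α + i))) * f v := by
      rw [← hp, ← map_mul, ← map_mul, ← map_mul, mul_assoc, mul_assoc, ← hv.dn_mul]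
      simp only [mul_assoc]
    rw [show β + m + i + (e + 1) = β + (m + i + (e + 1)) by omega, add_assoc, hc, hc]
    congr 2
    rw [show α + (m + i) = m + (α + i) by omega, ← map_mul, ← hx.dn_mul, map_mul, h, ← map_mul,
      hy.dn_mul, map_mul]
    congr 3
    omega
  refine ⟨p + 2, p, by omega, ?_⟩
  rw [← map_pow, ← map_pow]
  -- Three shifts by `e + 1` give the required gap `3 * e + 3`.
  apply map_circ_pow_add_two (k := β + m) (e := 3 * e)
  rw [← add_zero (β + m), key, add_zero, key, add_assoc, key]
  congr 3
  omega

/-- A homomorphism from `SK_ω` which is not injective identifies two powers of the circle. -/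
theorem exists_map_circ_pow_eq {M : Type*} [Monoid M] (f : SK →* M) {x y : SK} (hne : x ≠ y)
    (h : f x = f y) : ∃ k l, k ≠ l ∧ f circ ^ k = f circ ^ l := by
  obtain ⟨n₁, m₁, hx⟩ := exists_strands x
  obtain ⟨n₂, m₂, hy⟩ := exists_strands y
  replace hx := hx.add n₂
  replace hy := hy.add n₁
  rw [add_comm n₂] at hy
  generalize n₁ + n₂ = n at hx hy
  generalize m₁ + n₂ = m at hx
  generalize m₂ + n₁ = m' at hy
  rcases lt_trichotomy m m' with hm | rfl | hm
  · exact exists_map_circ_pow_eq_of_lt f hx hy hm h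
  · obtain ⟨a, ha⟩ := exists_bend n
    obtain ⟨b, hb⟩ := ha m
    obtain ⟨r, p, π, hπ, hr, h1⟩ := exists_eq_of_strands_zero (hb x hx).1
    obtain ⟨r', q, ρ, hρ, hr', h2⟩ := exists_eq_of_strands_zero (hb y hy).1
    obtain rfl : r = r' := by omega
    have hne' : circ ^ p * (dn 0 ^ r * π) ≠ circ ^ q * (dn 0 ^ r * ρ) := by
      intro h'
      rw [← h1, ← h2] at h'
      exact hne (by rw [← (hb x hx).2, ← (hb y hy).2, h'])
    have hf (z : SK) : f (circ ^ p * (dn 0 ^ r * (π * z))) =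
        f (circ ^ q * (dn 0 ^ r * (ρ * z))) := by
      have : f (a * x * z) = f (a * y * z) := by simp only [map_mul, h]
      rw [h1, h2] at this
      simpa only [mul_assoc] using this
    obtain ⟨π', hπ', h3, h3'⟩ := exists_inverse_of_mem_crossings hπ
    obtain ⟨ρ', hρ', h4, h4'⟩ := exists_inverse_of_mem_crossings hρ
    have hcirc (k : ℕ) : dn 0 ^ k * up 0 ^ k = circ ^ k := by
      induction k with
      | zero => simp
      | succ k ih =>
        rw [pow_succ, pow_succ', ← mul_assoc, mul_assoc _ (dn 0), dn_up_self, ← circ_mul_comm,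
          mul_assoc, ih, pow_succ']
    obtain ⟨s, hs, h5, h6⟩ := exists_dn_zero_pow_mul_up_zero_pow (mul_mem hρ hπ')
    obtain ⟨s', hs', h5', h6'⟩ := exists_dn_zero_pow_mul_up_zero_pow (mul_mem hπ hρ')
    have e1 : f circ ^ (p + r) = f circ ^ (q + s) := by
      have := hf (π' * up 0 ^ r)
      rw [← mul_assoc π, h3, one_mul, hcirc, ← mul_assoc ρ, ← mul_assoc (dn 0 ^ r), h5,
        ← pow_add, ← pow_add] at this
      simpa only [map_pow] using this
    have e2 : f circ ^ (p + s') = f circ ^ (q + r) := by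
      have := hf (ρ' * up 0 ^ r)
      rw [← mul_assoc ρ, h4, one_mul, hcirc, ← mul_assoc π, ← mul_assoc (dn 0 ^ r), h5',
        ← pow_add, ← pow_add] at this
      simpa only [map_pow] using this
    by_contra! H
    -- As `s, s' ≤ r`, these equations force `p = q` and `s = r`, so the two systems of arcs
    -- coincide.
    have e1' : p + r = q + s := by_contra fun hh => H _ _ hh e1
    have e2' : p + s' = q + r := by_contra fun hh => H _ _ hh e2
    have h7 := h6 (by omega)
    obtain rfl : p = q := by omega
    refine hne' ?_
    conv_lhs => rw [← h7]
    simp only [mul_assoc]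
    rw [h3', mul_one]
  · exact exists_map_circ_pow_eq_of_lt f hy hx hm h.symm

/-! ### A representation in which the circle acts as 2 -/

/-- Insert the letter `a` twice in front of the letter with the index `k`. -/
def insertPair (k : ℕ) (a : Bool) (x : ℕ → Bool) : ℕ → Bool :=
  fun i => if i < k then x i else if i < k + 2 then a else x (i - 2)

/-- Remove the letters with the indices `k` and `k + 1`. -/
def removePair (k : ℕ) (x : ℕ → Bool) : ℕ → Bool :=
  fun i => if i < k then x i else x (i + 2)

/-- Exchange the letters with the indices `k` and `k + 1`. -/
def swapPair (k : ℕ) (x : ℕ → Bool) : ℕ → Bool :=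
  fun i => if i = k then x (k + 1) else if i = k + 1 then x k else x i

/-- The action of the generators on functions of binary sequences: cups are contractions with the
standard bilinear form on a module of rank two, caps are its insertions, and crossings are
transpositions of tensor factors. -/
def genAct : Gen → Function.End ((ℕ → Bool) → ℕ)
  | .cup k => fun φ x => φ (insertPair k false x) + φ (insertPair k true x)
  | .cap k => fun φ x => if x k = x (k + 1) then φ (removePair k x) else 0
  | .cross k => fun φ x => φ (swapPair k x)

theorem lift_genAct_eq {a b : Term} (h : SKRel a b) :
    FreeMonoid.lift genAct a = FreeMonoid.lift genAct b := by
  have le_coe {j k : ℕ+} (h : j ≤ k) : (j : ℕ) ≤ k := h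
  have one_apply (φ : (ℕ → Bool) → ℕ) : (1 : Function.End ((ℕ → Bool) → ℕ)) φ = φ := rfl
  have mul_apply (f g : Function.End ((ℕ → Bool) → ℕ)) (φ : (ℕ → Bool) → ℕ) :
    (f * g) φ = f (g φ) := rfl
  cases h
  all_goals
    funext φ x
    simp only [map_mul, map_one, cup, cap, cross, FreeMonoid.lift_eval_of, mul_apply, one_apply]
    simp only [genAct, PNat.add_coe, PNat.val_ofNat]
  case cup_cup j k h =>
    replace h := le_coe h
    have (a b : Bool) : insertPair (k + 2) a (insertPair j b x) =
        insertPair j b (insertPair k a x) := by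
      funext i; grind [insertPair]
    simp only [this]; omega
  case cap_cap j k h =>
    replace h := le_coe h
    have : removePair k (removePair j x) = removePair j (removePair (k + 2) x) := by
      funext i; grind [removePair]
    rw [this]; grind [removePair]
  case cup_cap_comm j k h =>
    replace h := le_coe h
    have (a : Bool) : removePair j (insertPair (k + 2) a x) = insertPair k a (removePair j x) := by
      funext i; grind [removePair, insertPair]
    simp only [this]; grind [insertPair]
  case cap_cup_comm j k h =>
    replace h := le_coe h
    have (a : Bool) : removePair (k + 2) (insertPair j a x) = insertPair j a (removePair k x) := by
      funext i; grind [removePair, insertPair]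
    simp only [this]; grind [insertPair]
  case cup_cap k =>
    have (a : Bool) (h : a = x k) : removePair (k + 1) (insertPair k a x) = x := by
      funext i; grind [removePair, insertPair]
    grind [insertPair]
  case cross_comm j k h =>
    replace h := le_coe h
    congr 1; funext i; grind [swapPair]
  case cross_sq i =>
    congr 1; funext i; grind [swapPair]
  case cross_braid i =>
    congr 1; funext i; grind [swapPair]
  case cross_cup_one j k h =>
    replace h := le_coe h
    congr 2 <;> funext i <;> grind [swapPair, insertPair]
  case cross_cup_two j k h =>
    replace h := le_coe h
    congr 2 <;> funext i <;> grind [swapPair, insertPair]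
  case cross_cup_three i =>
    congr 2 <;> funext i <;> grind [swapPair, insertPair]
  case cross_cup_four i =>
    congr 2 <;> funext i <;> grind [swapPair, insertPair]
  case cross_cap_one j k h =>
    replace h := le_coe h
    have : removePair (k + 2) (swapPair j x) = swapPair j (removePair (k + 2) x) := by
      funext i; grind [removePair, swapPair]
    rw [this]; grind [swapPair]
  case cross_cap_two j k h =>
    replace h := le_coe h
    have : removePair j (swapPair (k + 2) x) = swapPair k (removePair j x) := by
      funext i; grind [removePair, swapPair]
    rw [this]; grind [swapPair]
  case cross_cap_three k =>
    have : removePair k (swapPair k x) = removePair k x := by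
      funext i; grind [removePair, swapPair]
    rw [this]; grind [swapPair]
  case cross_cap_four k =>
    have (h : x k = x (k + 2)) :
        removePair (k + 1) (swapPair k x) = removePair k (swapPair (k + 1) x) := by
      funext i; grind [removePair, swapPair]
    grind [swapPair]

/-- The action of `SK_ω` on functions of binary sequences. -/
def action : SK →* Function.End ((ℕ → Bool) → ℕ) :=
  PresentedMonoid.lift genAct fun _ _ => lift_genAct_eq

theorem action_circ_pow (n : ℕ) (φ : (ℕ → Bool) → ℕ) (x : ℕ → Bool) :
    action (circ ^ n) φ x = 2 ^ n * φ x := by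
  have h (φ : (ℕ → Bool) → ℕ) (x : ℕ → Bool) : action circ φ x = 2 * φ x := by
    change genAct (.cup 1) (genAct (.cap 1) φ) x = _
    have (a : Bool) : removePair 1 (insertPair 1 a x) = x := by
      funext i; grind [removePair, insertPair]
    simp only [genAct, PNat.val_ofNat, this]
    grind [insertPair]
  induction n with
  | zero => rw [pow_zero, pow_zero, one_mul, map_one]; rfl
  | succ n ih =>
    rw [pow_succ', pow_succ', map_mul]
    change action circ (action (circ ^ n) φ) x = _
    rw [h, ih, mul_assoc]

/-- Evaluated on the constant function 1, the equation says that `2 ^ n` divides `2 ^ m`. -/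
theorem le_of_circ_pow_eq_circ_pow_mul {m n : ℕ} {x : SK} (h : circ ^ m = circ ^ n * x) :
    n ≤ m := by
  have h1 := action_circ_pow m (fun _ => 1) (fun _ => false)
  rw [h, map_mul] at h1
  change action (circ ^ n) (action x fun _ => 1) (fun _ => false) = _ at h1
  rw [action_circ_pow, mul_one] at h1
  exact (Nat.pow_dvd_pow_iff_le_right (by norm_num)).1 ⟨_, h1.symm⟩

theorem circ_pow_injective {k l : ℕ} (h : circ ^ k = circ ^ l) : k = l :=
  le_antisymm (le_of_circ_pow_eq_circ_pow_mul (x := 1) (by rw [mul_one, h]))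
    (le_of_circ_pow_eq_circ_pow_mul (x := 1) (by rw [mul_one, h]))

/-! ### Surjective endomorphisms and the main theorem -/

/-- A surjective endomorphism of `SK_ω` does not identify powers of the circle. -/
theorem map_circ_pow_injective_of_surjective {f : SK →* SK} (hf : Function.Surjective f) {k l : ℕ}
    (hkl : k < l) : f circ ^ k ≠ f circ ^ l := by
  intro h
  obtain ⟨x, hx⟩ := hf circ
  obtain ⟨u, v, m, hm⟩ := exists_mul_mul_eq_circ_pow x
  -- Closing a preimage of the circle shows that the circle divides a power of its own image.
  obtain ⟨y, hy⟩ : ∃ y, f circ ^ m = circ * y :=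
    ⟨f u * f v, by rw [← map_pow, ← hm, map_mul, map_mul, hx, ← circ_mul_comm, mul_assoc]⟩
  obtain ⟨e, rfl⟩ := Nat.exists_eq_add_of_lt hkl
  have periodic (n : ℕ) : f circ ^ (k + (e + 1) * n) = f circ ^ k := by
    induction n with
    | zero => simp
    | succ n ih =>
      rw [show k + (e + 1) * (n + 1) = k + (e + 1) * n + (e + 1) by ring, pow_add, ih, ← pow_add,
        h, add_assoc]
  have power (n : ℕ) : f circ ^ (m * n) = circ ^ n * y ^ n := by
    rw [pow_mul, hy]
    exact Commute.mul_pow (circ_mul_comm y) n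
  obtain ⟨u', v', j, hj⟩ := exists_mul_mul_eq_circ_pow (f circ ^ k)
  -- This `n` makes `m * n` a multiple of the period `e + 1` and exceeds `j`, the number of circles
  -- obtained by closing `f circ ^ k`.
  set n := (e + 1) * (j + 1) with hn
  have h1 : f circ ^ k = circ ^ n * (y ^ n * f circ ^ k) := by
    rw [← mul_assoc, ← power, ← pow_add, ← periodic (m * (j + 1))]
    congr 1
    rw [hn]
    ring
  rw [h1, ← mul_assoc, ← circ_pow_mul_comm, mul_assoc, mul_assoc] at hj
  have h2 := le_of_circ_pow_eq_circ_pow_mul hj.symm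
  have h3 : j + 1 ≤ n := Nat.le_mul_of_pos_left _ (Nat.succ_pos e)
  omega

end SymSelfAdj

theorem mainTheorem4 :
    (∀ t u : SymSelfAdj.Term, ¬ SymSelfAdj.HoldsInSK t u →
      ∃ k l : ℕ, k ≠ l ∧
        PresentedMonoid.mk (SymSelfAdj.AddRel t u) (SymSelfAdj.circle ^ k) =
          PresentedMonoid.mk (SymSelfAdj.AddRel t u) (SymSelfAdj.circle ^ l)) ∧
    (∀ (M : Type*) [Monoid M] (h : SymSelfAdj.SK →* M),
      (Function.Injective h ↔
        ∀ k l : ℕ, k ≠ l →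
          h (PresentedMonoid.mk SymSelfAdj.SKRel (SymSelfAdj.circle ^ k)) ≠
            h (PresentedMonoid.mk SymSelfAdj.SKRel (SymSelfAdj.circle ^ l))) ∧
      (Nonempty (SymSelfAdj.SK ≃* MonoidHom.mrange h) ↔
        ∀ k l : ℕ, k ≠ l →
          h (PresentedMonoid.mk SymSelfAdj.SKRel (SymSelfAdj.circle ^ k)) ≠
            h (PresentedMonoid.mk SymSelfAdj.SKRel (SymSelfAdj.circle ^ l)))) := by
  open SymSelfAdj in
  have mk_circle (k : ℕ) : PresentedMonoid.mk SKRel (circle ^ k) = circ ^ k := map_pow _ _ _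
  refine ⟨fun t u htu => ?_, fun M _ h => ?_⟩
  · have hlift (w : Term) : FreeMonoid.lift
        (fun g => PresentedMonoid.mk (AddRel t u) (FreeMonoid.of g)) w =
          PresentedMonoid.mk (AddRel t u) w :=
      DFunLike.congr_fun (FreeMonoid.lift_restrict (PresentedMonoid.mk (AddRel t u))) w
    let f : SK →* SKAdd t u := PresentedMonoid.lift
      (fun g => PresentedMonoid.mk (AddRel t u) (FreeMonoid.of g)) fun a b hab => by
        rw [hlift, hlift]
        exact PresentedMonoid.mk_eq_mk_of_rel (.inl hab)
    have hf (w : Term) : f (PresentedMonoid.mk SKRel w) = PresentedMonoid.mk (AddRel t u) w :=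
      hlift w
    obtain ⟨k, l, hkl, e⟩ := exists_map_circ_pow_eq f htu (by
      rw [hf, hf]
      exact PresentedMonoid.mk_eq_mk_of_rel (.inr ⟨rfl, rfl⟩))
    refine ⟨k, l, hkl, ?_⟩
    rwa [← hf, ← hf, mk_circle, mk_circle, map_pow, map_pow]
  · simp only [mk_circle]
    have inj_of (H : ∀ k l, k ≠ l → h (circ ^ k) ≠ h (circ ^ l)) : Function.Injective h := by
      intro x y hxy
      by_contra hne
      obtain ⟨k, l, hkl, e⟩ := exists_map_circ_pow_eq h hne hxy
      exact H k l hkl (by rw [map_pow, map_pow, e])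
    refine ⟨⟨fun hi k l hkl e => hkl (circ_pow_injective (hi e)), inj_of⟩, ?_, fun H => ?_⟩
    · rintro ⟨e⟩ k l hkl heq
      -- The isomorphism `e` need not be induced by `h`; composing its inverse with `h` gives a
      -- surjective endomorphism.
      let f : SK →* SK := e.symm.toMonoidHom.comp h.mrangeRestrict
      have hf : Function.Surjective f := e.symm.surjective.comp h.mrangeRestrict_surjective
      have hc : f circ ^ k = f circ ^ l := by
        rw [← map_pow, ← map_pow]
        exact congrArg e.symm (Subtype.ext heq)
      rcases lt_or_gt_of_ne hkl with hlt | hlt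
      · exact map_circ_pow_injective_of_surjective hf hlt hc
      · exact map_circ_pow_injective_of_surjective hf hlt hc.symm
    · exact ⟨MulEquiv.ofBijective h.mrangeRestrict
        ⟨fun x y hxy => inj_of H (congrArg Subtype.val hxy), h.mrangeRestrict_surjective⟩⟩
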